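/- Let \(X\) be a real or complex Banach space. For a sequence \((x_k)_{k\ge 1}\) in \(X\) put \[ \operatorname{ca}(x_k)=\inf_{n\in\mathbb N}\sup\{\|x_k-x_l\| : k,l\ge n\},\qquad \operatorname{cca}(x_k)=\operatorname{ca}\Bigl(\tfrac1k\sum_{i=1}^k x_i\Bigr), \] \[ \widetilde{\operatorname{cca}}(x_k)=\inf\{\operatorname{cca}(x_{k_n}) : (x_{k_n})\text{ is a subsequence of }(x_k)\}. \] A sequence is called Cesàro convergent if its arithmetic means \(\frac1k\sum_{i=1}^k x_i\) converge in norm to a point of \(X\), and weakly convergent if it converges weakly to a point of \(X\). For a set \(A\subset X\) put (with \(\sup\emptyset=0\)) \[ \operatorname{bs}(A)=\sup\{\widetilde{\operatorname{cca}}(x_k) : (x_k)\text{ is a sequence in }A\}, \] \[ \operatorname{wbs}(A)=\sup\{\widetilde{\operatorname{cca}}(x_k) : (x_k)\text{ is a weakly convergent sequence in }A\}. \] A bounded set \(A\) is called a Banach–Saks set if every sequence in \(A\) has a Cesàro convergent subsequence; a set \(A\) is called a weak Banach–Saks set if every weakly convergent sequence in \(A\) has a Cesàro convergent subsequence. (The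 limits need not belong to \(A\).) Let \(A\) be a bounded subset of \(X\). 1. If \(\operatorname{wbs}(A)=0\), then \(A\) is a weak Banach–Saks set. 2. If \(\operatorname{bs}(A)=0\), then \(A\) is a Banach–Saks set. -/

import Mathlib

open Filter Topology
open scoped ENNReal

namespace BanachSaks

variable (𝕜 : Type*) [RCLike 𝕜] {X : Type*} [NormedAddCommGroup X] [NormedSpace 𝕜 X]

/-- The sequence of arithmetic means of `x`. Sequences are indexed from `0`, so the entry of
index `k` is the mean of the first `k + 1` terms. -/
noncomputable def cesaroMean (x : ℕ → X) (k : ℕ) : X :=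
  ((k + 1 : ℕ) : 𝕜)⁻¹ • ∑ i ∈ Finset.range (k + 1), x i

/-- `x` is Cesàro convergent: its arithmetic means converge in norm to some point of `X`. -/
def CesaroConvergent (x : ℕ → X) : Prop :=
  ∃ y : X, Tendsto (cesaroMean 𝕜 x) atTop (𝓝 y)

/-- `x` converges weakly to some point of `X`. -/
def WeaklyConvergent (x : ℕ → X) : Prop :=
  ∃ y : X, Tendsto (fun k => toWeakSpace 𝕜 X (x k)) atTop (𝓝 (toWeakSpace 𝕜 X y))

/-- `ca (x_k) = inf_n sup {‖x_k - x_l‖ : k, l ≥ n}`. All the quantities here take values in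
`[0, ∞]`, where every supremum and infimum exists and the empty supremum is `0`;
they are finite for bounded sequences and bounded sets. -/
noncomputable def ca (x : ℕ → X) : ℝ≥0∞ :=
  ⨅ n : ℕ, ⨆ (k : ℕ) (_ : n ≤ k) (l : ℕ) (_ : n ≤ l), ‖x k - x l‖ₑ

/-- `cca (x_k)` is the quantity `ca` of the sequence of arithmetic means of `(x_k)`. -/
noncomputable def cca (x : ℕ → X) : ℝ≥0∞ :=
  ca (cesaroMean 𝕜 x)

/-- The infimum of `cca` over all subsequences of `x`. -/
noncomputable def tcca (x : ℕ → X) : ℝ≥0∞ :=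
  ⨅ (φ : ℕ → ℕ) (_ : StrictMono φ), cca 𝕜 (x ∘ φ)

/-- The supremum of `tcca` over all sequences in `A`. -/
noncomputable def bs (A : Set X) : ℝ≥0∞ :=
  ⨆ (x : ℕ → X) (_ : ∀ k, x k ∈ A), tcca 𝕜 x

/-- The supremum of `tcca` over all weakly convergent sequences in `A`
(the weak limit may lie outside `A`). -/
noncomputable def wbs (A : Set X) : ℝ≥0∞ :=
  ⨆ (x : ℕ → X) (_ : ∀ k, x k ∈ A) (_ : WeaklyConvergent 𝕜 x), tcca 𝕜 x

/-- A bounded set each sequence of which has a Cesàro convergent subsequence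
(the Cesàro limit may lie outside `A`). -/
def IsBanachSaksSet (A : Set X) : Prop :=
  Bornology.IsBounded A ∧
    ∀ x : ℕ → X, (∀ k, x k ∈ A) → ∃ φ : ℕ → ℕ, StrictMono φ ∧ CesaroConvergent 𝕜 (x ∘ φ)

/-- A set each weakly convergent sequence of which has a Cesàro convergent subsequence
(the limits may lie outside `A`). -/
def IsWeakBanachSaksSet (A : Set X) : Prop :=
  ∀ x : ℕ → X, (∀ k, x k ∈ A) → WeaklyConvergent 𝕜 x →
    ∃ φ : ℕ → ℕ, StrictMono φ ∧ CesaroConvergent 𝕜 (x ∘ φ)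

end BanachSaks

/-! If `bs A = 0` (or `wbs A = 0`), every subsequence of an admissible sequence is again admissible,
so it has subsequences with `cca` as small as desired. Diagonalising over these is not enough, since
`cca` may grow when passing to a subsequence. Ramsey's theorem removes this obstacle: for each block
length `K` and tolerance `1 / (j + 1)`, colour `2K`-tuples by whether the averages of their two
halves agree up to the tolerance, and pass to one subsequence eventually homogeneous for all these
colourings (`exists_strictMono_blockSum_homogeneous`). A further subsequence of small `cca` has two
successive blocks with close averages (`norm_blockSum_sub_blockSum_le`), which excludes the bad
colour for some `K`. The good colour makes all late blocks average to nearly the same vector, so the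
means cluster near it (`exists_eventually_norm_cesaroMean_sub_le`). As `j` is arbitrary, they are
Cauchy. -/

namespace BanachSaks

/-! ### Ramsey's theorem via an ultrafilter -/

section Ramsey

/-- The list `[f (history k), …]` of the first `k` choices, latest first, where each choice is made
by `f` from the preceding ones. -/
def history (f : List ℕ → ℕ) : ℕ → List ℕ
  | 0 => []
  | k + 1 => f (history f k) :: history f k

theorem length_history (f : List ℕ → ℕ) (k : ℕ) : (history f k).length = k := by
  induction k with
  | zero => rfl
  | succ k ih => simp [history, ih]

/-- Every tuple of earlier choices occurs among the finitely many sublists of the history, so one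
new choice can serve them all. -/
theorem map_sublist_history (f : List ℕ → ℕ) (a : ℕ) :
    ∀ d : List ℕ, d.Pairwise (· > ·) → (∀ i ∈ d, i < a) →
      (d.map fun k => f (history f k)).Sublist (history f a) := by
  induction a with
  | zero =>
    intro d _ h
    cases d with
    | nil => simp
    | cons b d => exact absurd (h b (by simp)) (by omega)
  | succ a ih =>
    intro d hd h
    cases d with
    | nil => simp
    | cons b d =>
      rw [List.pairwise_cons] at hd
      have hb : b < a + 1 := h b (by simp)
      rcases Nat.lt_succ_iff_lt_or_eq.1 hb with hlt | rfl
      · refine (ih (b :: d) (List.pairwise_cons.2 hd) ?_).cons _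
        intro i hi
        rcases List.mem_cons.1 hi with rfl | hi
        · exact hlt
        · exact (hd.1 i hi).trans hlt
      · exact (ih d hd.2 fun i hi => hd.1 i hi).cons_cons _

/-- A fusion argument along an ultrafilter: countably many families of lists, each of which can be
extended by almost every number, have a common sequence all of whose finite tuples they contain. -/
theorem exists_strictMono_forall_of_eventually_cons (G : ℕ → List ℕ → Prop) (r : ℕ → ℕ)
    (h_nil : ∀ n, G n [])
    (h_cons : ∀ n l, l.length < r n → G n l → ∀ᶠ m in (hyperfilter ℕ : Filter ℕ), G n (m :: l)) :
    ∃ φ : ℕ → ℕ, StrictMono φ ∧ ∀ n (d : List ℕ), d.Pairwise (· > ·) → (∀ i ∈ d, n ≤ i) →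
      d.length ≤ r n → G n (d.map φ) := by
  -- Family `n` is considered only once `n` choices have been made, so each choice faces finitely
  -- many conditions, each true for almost every `m`.
  have key : ∀ h : List ℕ, ∃ m, (∀ i ∈ h, i < m) ∧ ∀ n ∈ Finset.range (h.length + 1),
      ∀ l ∈ h.sublists.toFinset, l.length < r n → G n l → G n (m :: l) := by
    intro h
    have h1 : ∀ᶠ m in (hyperfilter ℕ : Filter ℕ), ∀ i ∈ h.toFinset, i < m := by
      rw [Filter.eventually_all_finset]
      intro i _
      have : ∀ᶠ m in (cofinite : Filter ℕ), i < m := by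
        rw [Nat.cofinite_eq_atTop]; exact eventually_gt_atTop i
      exact this.filter_mono hyperfilter_le_cofinite
    have h2 : ∀ᶠ m in (hyperfilter ℕ : Filter ℕ), ∀ n ∈ Finset.range (h.length + 1),
        ∀ l ∈ h.sublists.toFinset, l.length < r n → G n l → G n (m :: l) := by
      rw [Filter.eventually_all_finset]
      intro n _
      rw [Filter.eventually_all_finset]
      intro l _
      by_cases hl : l.length < r n ∧ G n l
      · exact (h_cons n l hl.1 hl.2).mono fun m hm _ _ => hm
      · exact Eventually.of_forall fun m h1 h2 => absurd ⟨h1, h2⟩ hl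
    obtain ⟨m, hm1, hm2⟩ := (h1.and h2).exists
    exact ⟨m, fun i hi => hm1 i (List.mem_toFinset.2 hi), hm2⟩
  choose f hf1 hf2 using key
  refine ⟨fun k => f (history f k), strictMono_nat_of_lt_succ fun k => ?_, ?_⟩
  · exact hf1 _ _ (by simp [history])
  · intro n d
    induction d with
    | nil => intro _ _ _; exact h_nil n
    | cons a d ih =>
      intro hd hn hr
      rw [List.pairwise_cons] at hd
      rw [List.length_cons] at hr
      refine hf2 (history f a) n ?_ _ ?_ ?_ ?_
      · rw [length_history, Finset.mem_range]
        exact Nat.lt_succ_of_le (hn a (by simp))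
      · rw [List.mem_toFinset, List.mem_sublists]
        exact map_sublist_history f a d hd.2 fun i hi => hd.1 i hi
      · simpa using hr
      · exact ih hd.2 (fun i hi => hn i (by simp [hi])) (by omega)

/-- `P` holds for almost all extensions of a list by `j` further entries, the quantifier
"almost all" being iterated. -/
def EventuallyExtend (P : List ℕ → Prop) : ℕ → List ℕ → Prop
  | 0, l => P l
  | j + 1, l => ∀ᶠ m in (hyperfilter ℕ : Filter ℕ), EventuallyExtend P j (m :: l)

/-- Negation passes through each quantifier because the filter is an ultrafilter; this gives the
dichotomy between the two colours. -/
theorem not_eventuallyExtend (P : List ℕ → Prop) (j : ℕ) :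
    ∀ l, ¬ EventuallyExtend P j l ↔ EventuallyExtend (fun l => ¬ P l) j l := by
  induction j with
  | zero => intro l; rfl
  | succ j ih =>
    intro l
    simp only [EventuallyExtend, ← ih]
    exact Ultrafilter.eventually_not.symm

/-- Ramsey's theorem for countably many colourings of tuples: some infinite set is homogeneous for
the `n`-th colouring from its `n`-th element on. Tuples are decreasing lists. -/
theorem exists_strictMono_forall_or_forall_not (P : ℕ → List ℕ → Prop) (r : ℕ → ℕ) :
    ∃ φ : ℕ → ℕ, StrictMono φ ∧ ∀ n,
      (∀ d : List ℕ, d.Pairwise (· > ·) → (∀ i ∈ d, n ≤ i) → d.length = r n → P n (d.map φ)) ∨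
      (∀ d : List ℕ, d.Pairwise (· > ·) → (∀ i ∈ d, n ≤ i) → d.length = r n →
        ¬ P n (d.map φ)) := by
  have h : ∀ n, ∃ R : List ℕ → Prop, EventuallyExtend R (r n) [] ∧
      (R = P n ∨ R = fun l => ¬ P n l) := by
    intro n
    by_cases hn : EventuallyExtend (P n) (r n) []
    · exact ⟨_, hn, Or.inl rfl⟩
    · exact ⟨_, (not_eventuallyExtend _ _ _).1 hn, Or.inr rfl⟩
  choose R hR hRP using h
  obtain ⟨φ, hφ, H⟩ := exists_strictMono_forall_of_eventually_cons
    (fun n l => EventuallyExtend (R n) (r n - l.length) l) r (fun n => by simpa using hR n) (by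
      intro n l hl h
      obtain ⟨j, hj⟩ : ∃ j, r n - l.length = j + 1 := ⟨r n - l.length - 1, by omega⟩
      have hj' : ∀ m, r n - (m :: l).length = j := fun m => by
        rw [List.length_cons]; omega
      simp only [hj, hj'] at h ⊢
      exact h)
  have H' : ∀ n (d : List ℕ), d.Pairwise (· > ·) → (∀ i ∈ d, n ≤ i) → d.length = r n →
      R n (d.map φ) := by
    intro n d h1 h2 h3
    have := H n d h1 h2 h3.le
    simpa [h3, EventuallyExtend] using this
  refine ⟨φ, hφ, fun n => ?_⟩
  have := H' n
  rcases hRP n with h | h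
  · left; simpa only [h] using this
  · right; simpa only [h] using this

end Ramsey

/-! ### Sums over blocks -/

section BlockSums

variable {X : Type*} [NormedAddCommGroup X]

/-- The sum of the `K` terms of `x` that start at index `p`. -/
def blockSum (x : ℕ → X) (p K : ℕ) : X := ∑ i ∈ Finset.range K, x (p + i)

theorem sum_range_add_blockSum (x : ℕ → X) (p K : ℕ) :
    ∑ i ∈ Finset.range (p + K), x i = ∑ i ∈ Finset.range p, x i + blockSum x p K :=
  Finset.sum_range_add x p K

/-- Ramsey's theorem with colouring number `Nat.pair K j`. The map `e` keeps the dichotomy available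
for further subsequences. -/
theorem exists_strictMono_blockSum_homogeneous (x : ℕ → X) :
    ∃ φ : ℕ → ℕ, StrictMono φ ∧ ∀ K j : ℕ,
      (∀ e : ℕ → ℕ, StrictMono e → ∀ p q, Nat.pair K j ≤ e p → p + K ≤ q →
        ‖blockSum (x ∘ φ ∘ e) q K - blockSum (x ∘ φ ∘ e) p K‖ ≤ K * (1 / ((j : ℝ) + 1))) ∨
      (∀ e : ℕ → ℕ, StrictMono e → ∀ p q, Nat.pair K j ≤ e p → p + K ≤ q →
        K * (1 / ((j : ℝ) + 1)) < ‖blockSum (x ∘ φ ∘ e) q K - blockSum (x ∘ φ ∘ e) p K‖) := by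
  obtain ⟨φ, hφ, H⟩ := exists_strictMono_forall_or_forall_not
    (fun n l => ‖((l.take n.unpair.1).map x).sum - ((l.drop n.unpair.1).map x).sum‖ ≤
      n.unpair.1 * (1 / ((n.unpair.2 : ℝ) + 1))) (fun n => n.unpair.1 + n.unpair.1)
  refine ⟨φ, hφ, fun K j => ?_⟩
  have hsum : ∀ (y : ℕ → X) (p : ℕ),
      ((((List.range K).map fun i => p + i).reverse).map y).sum = blockSum y p K := by
    intro y p
    rw [List.map_reverse, List.sum_reverse, List.map_map, blockSum, ← List.toFinset_range,
      List.sum_toFinset _ List.nodup_range]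
    rfl
  set D : (ℕ → ℕ) → ℕ → ℕ → List ℕ := fun e p q =>
    (((List.range K).map fun i => q + i).reverse ++
      ((List.range K).map fun i => p + i).reverse).map e with hD
  have hpw : ∀ e : ℕ → ℕ, StrictMono e → ∀ p q, p + K ≤ q → (D e p q).Pairwise (· > ·) := by
    intro e he p q hpq
    have hblock : ∀ p : ℕ, (((List.range K).map fun i => p + i).reverse).Pairwise (· > ·) := by
      intro p
      rw [List.pairwise_reverse, List.pairwise_map]
      exact List.pairwise_lt_range.imp fun h => by omega
    rw [hD]
    refine List.Pairwise.map _ (fun a b h => he h) (List.pairwise_append.2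
      ⟨hblock q, hblock p, ?_⟩)
    intro a ha b hb
    simp only [List.mem_reverse, List.mem_map, List.mem_range] at ha hb
    omega
  have hge : ∀ e : ℕ → ℕ, StrictMono e → ∀ p q, Nat.pair K j ≤ e p → p + K ≤ q →
      ∀ i ∈ D e p q, Nat.pair K j ≤ i := by
    intro e he p q h0 hpq i hi
    obtain ⟨a, ha, rfl⟩ := List.mem_map.1 hi
    simp only [List.mem_append, List.mem_reverse, List.mem_map, List.mem_range] at ha
    exact h0.trans (he.monotone (by omega))
  have hlen : ∀ (e : ℕ → ℕ) (p q : ℕ), (D e p q).length = K + K := by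
    intro e p q; simp [hD]
  have htake : ∀ (e : ℕ → ℕ) (p q : ℕ),
      ((((D e p q).map φ).take K).map x).sum = blockSum (x ∘ φ ∘ e) q K := by
    intro e p q
    rw [← hsum]
    simp [hD, Function.comp_def]
  have hdrop : ∀ (e : ℕ → ℕ) (p q : ℕ),
      ((((D e p q).map φ).drop K).map x).sum = blockSum (x ∘ φ ∘ e) p K := by
    intro e p q
    rw [← hsum]
    simp [hD, Function.comp_def]
  have := H (Nat.pair K j)
  simp only [Nat.unpair_pair] at this
  rcases this with h | h
  · left
    intro e he p q h0 hpq
    have := h (D e p q) (hpw e he p q hpq) (hge e he p q h0 hpq) (hlen e p q)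
    rwa [htake, hdrop] at this
  · right
    intro e he p q h0 hpq
    have := h (D e p q) (hpw e he p q hpq) (hge e he p q h0 hpq) (hlen e p q)
    rwa [htake, hdrop, not_le] at this

/-- If all blocks of length `K` from `p` on have sums of norm at most `K * ε`, then the partial
sums of `z` exceed `k * ε` at most by a constant. -/
theorem exists_norm_sum_range_le {z : ℕ → X} {C ε : ℝ} (hC : ∀ i, ‖z i‖ ≤ C) (hε : 0 ≤ ε)
    {p K : ℕ} (hK : 0 < K) (h : ∀ q, p ≤ q → ‖blockSum z q K‖ ≤ K * ε) :
    ∃ D : ℝ, ∀ k, ‖∑ i ∈ Finset.range k, z i‖ ≤ D + k * ε := by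
  have hC0 : 0 ≤ C := (norm_nonneg _).trans (hC 0)
  refine ⟨(p + K : ℕ) * C, fun k => ?_⟩
  -- Strip final blocks of length `K`, each costing `K * ε`, until fewer than `p + K` terms remain.
  induction k using Nat.strong_induction_on with
  | _ k ih =>
    rcases lt_or_ge k (p + K) with hk | hk
    · calc ‖∑ i ∈ Finset.range k, z i‖ ≤ ∑ i ∈ Finset.range k, ‖z i‖ := norm_sum_le _ _
        _ ≤ ∑ i ∈ Finset.range k, C := Finset.sum_le_sum fun i _ => hC i
        _ = k * C := by simp
        _ ≤ (p + K : ℕ) * C := by gcongr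
        _ ≤ (p + K : ℕ) * C + k * ε := le_add_of_nonneg_right (by positivity)
    · obtain ⟨m, rfl⟩ : ∃ m, k = m + K := ⟨k - K, by omega⟩
      rw [sum_range_add_blockSum]
      have h1 := ih m (by omega)
      have h2 := h m (by omega)
      have h3 := norm_add_le (∑ i ∈ Finset.range m, z i) (blockSum z m K)
      push_cast at h1 ⊢
      linarith

end BlockSums

/-! ### From block averages to Cesàro convergence -/

section Cesaro

variable {𝕜 : Type*} [RCLike 𝕜] {X : Type*} [NormedAddCommGroup X] [NormedSpace 𝕜 X]

theorem natCast_smul_cesaroMean (x : ℕ → X) (k : ℕ) :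
    ((k + 1 : ℕ) : 𝕜) • cesaroMean 𝕜 x k = ∑ i ∈ Finset.range (k + 1), x i :=
  smul_inv_smul₀ (Nat.cast_ne_zero.2 k.succ_ne_zero) _

theorem nsmul_cesaroMean (x : ℕ → X) (k : ℕ) :
    (k + 1) • cesaroMean 𝕜 x k = ∑ i ∈ Finset.range (k + 1), x i := by
  rw [← natCast_smul_cesaroMean (𝕜 := 𝕜), Nat.cast_smul_eq_nsmul]

include 𝕜 in
theorem norm_nsmul_eq (n : ℕ) (x : X) : ‖n • x‖ = n * ‖x‖ := by
  rw [← Nat.cast_smul_eq_nsmul 𝕜, norm_smul, RCLike.norm_natCast]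

theorem mul_norm_cesaroMean_sub (x : ℕ → X) (b : X) (k : ℕ) :
    ((k + 1 : ℕ) : ℝ) * ‖cesaroMean 𝕜 x k - b‖ = ‖∑ i ∈ Finset.range (k + 1), (x i - b)‖ := by
  rw [← norm_nsmul_eq (𝕜 := 𝕜), smul_sub, nsmul_cesaroMean, Finset.sum_sub_distrib,
    Finset.sum_const, Finset.card_range]

/-- If the sums over any two successive blocks of length `K` differ by at most `K * ε`, then the
arithmetic means are eventually `2ε`-close to a fixed vector. -/
theorem exists_eventually_norm_cesaroMean_sub_le {y : ℕ → X} {C ε : ℝ} (hC : ∀ i, ‖y i‖ ≤ C)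
    (hε : 0 < ε) {K : ℕ} (hK : 0 < K) {N : ℕ}
    (h : ∀ p q, N ≤ p → p + K ≤ q → ‖blockSum y q K - blockSum y p K‖ ≤ K * ε) :
    ∃ b : X, ∀ᶠ k in atTop, ‖cesaroMean 𝕜 y k - b‖ ≤ 2 * ε := by
  set b : X := (K : 𝕜)⁻¹ • blockSum y N K with hb
  have hKb : K • b = blockSum y N K := by
    rw [hb, ← Nat.cast_smul_eq_nsmul 𝕜, smul_inv_smul₀ (Nat.cast_ne_zero.2 hK.ne')]
  obtain ⟨D, hD⟩ := exists_norm_sum_range_le (z := fun i => y i - b) (C := C + ‖b‖) (p := N + K)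
    (fun i => (norm_sub_le _ _).trans (by gcongr; exact hC i)) hε.le hK (by
      intro q hq
      have := h N q le_rfl hq
      rwa [← hKb, blockSum, ← Finset.card_range K, ← Finset.sum_const, Finset.card_range,
        ← Finset.sum_sub_distrib] at this)
  refine ⟨b, ?_⟩
  -- From here on `D ≤ k * ε`, so the constant adds at most another `ε` to the mean.
  have hlim : ∀ᶠ k : ℕ in atTop, D / ε ≤ k := tendsto_natCast_atTop_atTop.eventually_ge_atTop _
  filter_upwards [hlim] with k hk
  have h1 := hD (k + 1)
  rw [← mul_norm_cesaroMean_sub (𝕜 := 𝕜)] at h1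
  rw [div_le_iff₀ hε] at hk
  have hpos : (0 : ℝ) < (k + 1 : ℕ) := by positivity
  refine le_of_mul_le_mul_left (h1.trans ?_) hpos
  push_cast
  nlinarith

theorem exists_norm_cesaroMean_sub_lt_of_cca_lt {y : ℕ → X} {δ : ℝ}
    (h : cca 𝕜 y < ENNReal.ofReal δ) :
    ∃ n, ∀ k ≥ n, ∀ l ≥ n, ‖cesaroMean 𝕜 y k - cesaroMean 𝕜 y l‖ < δ := by
  rw [cca, ca, iInf_lt_iff] at h
  obtain ⟨n, hn⟩ := h
  refine ⟨n, fun k hk l hl => ?_⟩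
  have h1 : ‖cesaroMean 𝕜 y k - cesaroMean 𝕜 y l‖ₑ < ENNReal.ofReal δ :=
    lt_of_le_of_lt
      (le_iSup₂_of_le k hk (le_iSup₂_of_le
        (f := fun l (_ : n ≤ l) => ‖cesaroMean 𝕜 y k - cesaroMean 𝕜 y l‖ₑ) l hl le_rfl)) hn
  rw [← ofReal_norm] at h1
  exact (ENNReal.ofReal_lt_ofReal_iff_of_nonneg (norm_nonneg _)).1 h1

/-- Almost constant arithmetic means have almost equal averages over `[K, 2K)` and `[2K, 3K)`. -/
theorem norm_blockSum_sub_blockSum_le {y : ℕ → X} {δ : ℝ} {n : ℕ}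
    (h : ∀ k ≥ n, ∀ l ≥ n, ‖cesaroMean 𝕜 y k - cesaroMean 𝕜 y l‖ < δ) :
    ‖blockSum y (n + 1 + (n + 1)) (n + 1) - blockSum y (n + 1) (n + 1)‖ ≤
      (n + 1 : ℕ) * (4 * δ) := by
  set a := cesaroMean 𝕜 y n
  set b := cesaroMean 𝕜 y (n + 1 + n)
  set c := cesaroMean 𝕜 y (n + 1 + (n + 1) + n)
  have ha : (n + 1) • a = ∑ i ∈ Finset.range (n + 1), y i := nsmul_cesaroMean y _
  have hb : (n + 1 + (n + 1)) • b = ∑ i ∈ Finset.range (n + 1 + (n + 1)), y i :=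
    nsmul_cesaroMean y _
  have hc : (n + 1 + (n + 1) + (n + 1)) • c =
      ∑ i ∈ Finset.range (n + 1 + (n + 1) + (n + 1)), y i := nsmul_cesaroMean y _
  rw [sum_range_add_blockSum, ← hb] at hc
  rw [sum_range_add_blockSum, ← ha] at hb
  -- With `K = n + 1`, the block sums are `2Kb - Ka` and `3Kc - 2Kb`; the coefficients 3 and 1 give
  -- the factor 4.
  have hq : blockSum y (n + 1 + (n + 1)) (n + 1) - blockSum y (n + 1) (n + 1) =
      (n + 1) • (3 • (c - b) + (a - b)) := by
    rw [← sub_eq_iff_eq_add'] at hb hc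
    rw [← hb, ← hc]
    simp only [add_smul, smul_add, smul_sub]
    module
  rw [hq, norm_nsmul_eq (𝕜 := 𝕜)]
  gcongr
  refine (norm_add_le _ _).trans ?_
  rw [norm_nsmul_eq (𝕜 := 𝕜)]
  have h1 := h (n + 1 + (n + 1) + n) (by omega) (n + 1 + n) (by omega)
  have h2 := h n le_rfl (n + 1 + n) (by omega)
  push_cast
  linarith

variable (𝕜) in
/-- A bounded sequence all of whose subsequences have subsequences with arbitrarily small `cca` has
a Cesàro convergent subsequence. -/
theorem exists_cesaroConvergent_of_tcca_eq_zero [CompleteSpace X] {x : ℕ → X} {C : ℝ}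
    (hC : ∀ i, ‖x i‖ ≤ C) (h : ∀ θ : ℕ → ℕ, StrictMono θ → tcca 𝕜 (x ∘ θ) = 0) :
    ∃ φ : ℕ → ℕ, StrictMono φ ∧ CesaroConvergent 𝕜 (x ∘ φ) := by
  obtain ⟨φ, hφ, H⟩ := exists_strictMono_blockSum_homogeneous x
  have good : ∀ j : ℕ, ∃ K, 0 < K ∧ ∀ p q, Nat.pair K j ≤ p → p + K ≤ q →
      ‖blockSum (x ∘ φ) q K - blockSum (x ∘ φ) p K‖ ≤ K * (1 / ((j : ℝ) + 1)) := by
    intro j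
    by_contra! hcon
    -- Thinning by `k ↦ Nat.pair k j` puts the terms from index `K` on past the homogeneity
    -- threshold `Nat.pair K j`, whichever `K` the small `cca` later dictates.
    have hθ : StrictMono fun k => Nat.pair k j := fun a b hab => Nat.pair_lt_pair_left j hab
    have hlt : tcca 𝕜 (x ∘ (φ ∘ fun k => Nat.pair k j)) <
        ENNReal.ofReal (1 / ((j : ℝ) + 1) / 4) := by
      rw [h _ (hφ.comp hθ)]
      exact ENNReal.ofReal_pos.2 (by positivity)
    simp only [tcca, iInf_lt_iff] at hlt
    obtain ⟨ψ, hψ, hlt⟩ := hlt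
    obtain ⟨n, hn⟩ := exists_norm_cesaroMean_sub_lt_of_cca_lt hlt
    have hle := norm_blockSum_sub_blockSum_le hn
    rw [mul_div_cancel₀ _ (four_ne_zero' ℝ)] at hle
    rcases H (n + 1) j with hg | hb
    · obtain ⟨p, q, hp, hpq, hK⟩ := hcon (n + 1) n.succ_pos
      exact absurd (hg id strictMono_id p q hp hpq) (not_le.2 hK)
    · exact absurd hle (not_le.2 (hb _ (hθ.comp hψ) (n + 1) (n + 1 + (n + 1))
        (hθ.monotone (hψ.id_le (n + 1))) le_rfl))
  refine ⟨φ, hφ, cauchySeq_tendsto_of_complete (Metric.cauchySeq_iff.2 fun ε hε => ?_)⟩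
  obtain ⟨j, hj⟩ := exists_nat_one_div_lt (show 0 < ε / 4 by positivity)
  obtain ⟨K, hK, hblock⟩ := good j
  obtain ⟨b, hb⟩ := exists_eventually_norm_cesaroMean_sub_le (𝕜 := 𝕜) (y := x ∘ φ)
    (fun i => hC (φ i)) (by positivity) hK hblock
  obtain ⟨n, hn⟩ := eventually_atTop.1 hb
  refine ⟨n, fun k hk l hl => ?_⟩
  have h1 := hn k hk
  have h2 := hn l hl
  rw [← dist_eq_norm] at h1 h2
  have h3 := dist_triangle_right (cesaroMean 𝕜 (x ∘ φ) k) (cesaroMean 𝕜 (x ∘ φ) l) b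
  linarith

end Cesaro

end BanachSaks

theorem corollary4p2 (𝕜 : Type*) [RCLike 𝕜] (X : Type*) [NormedAddCommGroup X]
    [NormedSpace 𝕜 X] [CompleteSpace X] (A : Set X) (hA : Bornology.IsBounded A) :
    (BanachSaks.wbs 𝕜 A = 0 → BanachSaks.IsWeakBanachSaksSet 𝕜 A) ∧
      (BanachSaks.bs 𝕜 A = 0 → BanachSaks.IsBanachSaksSet 𝕜 A) := by
  obtain ⟨C, hC⟩ := hA.exists_norm_le
  constructor
  · intro h x hx ⟨y, hy⟩
    refine BanachSaks.exists_cesaroConvergent_of_tcca_eq_zero 𝕜 (fun i => hC _ (hx i))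
      fun θ hθ => le_antisymm (le_of_le_of_eq ?_ h) bot_le
    exact le_iSup₂_of_le (x ∘ θ) (fun k => hx _)
      (le_iSup_of_le ⟨y, hy.comp hθ.tendsto_atTop⟩ le_rfl)
  · intro h
    refine ⟨hA, fun x hx => BanachSaks.exists_cesaroConvergent_of_tcca_eq_zero 𝕜
      (fun i => hC _ (hx i)) fun θ hθ => le_antisymm (le_of_le_of_eq ?_ h) bot_le⟩
    exact le_iSup₂_of_le (f := fun x (_ : ∀ k, x k ∈ A) => BanachSaks.tcca 𝕜 x) (x ∘ θ)
      (fun k => hx _) le_rfl
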